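/- Let $M=(V,\delta)$ be a metric space with $n\ge 1$ points and let $r\colon V\to(0,\infty)$ be a range assignment. Let $S$ be the symmetric disk graph of $M$ and $r$, i.e. the graph on $V$ in which two distinct points $u,v$ are adjacent if and only if $\delta(u,v)\le r(u)$ and $\delta(u,v)\le r(v)$. Every edge $\{u,v\}$ has weight $\delta(u,v)$, and the weight $w(G)$ of a graph $G$ on $V$ is the sum of the weights of its edges. Let $F$ be a minimum spanning forest of $S$, i.e. a graph of minimum weight among the acyclic subgraphs of $S$ on the vertex set $V$ that have the same connected components as $S$. Let $H$ be a Hamiltonian path of minimum weight in the complete graph on $V$. Then $$w(F)\le \log_{5/4} n\cdot w(H).$$ -/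

import Mathlib

namespace DiskGraph

/-- The weight of an edge of the complete graph on a metric space: the distance between its
two endpoints. -/
noncomputable def edgeWeight {V : Type*} [MetricSpace V] (e : Sym2 V) : ℝ :=
  Sym2.lift ⟨fun u v => dist u v, fun u v => dist_comm u v⟩ e

open Classical in
/-- The weight of a graph on a finite metric space: the sum of the weights of its edges. -/
noncomputable def graphWeight {V : Type*} [MetricSpace V] [Fintype V] (G : SimpleGraph V) : ℝ :=
  ∑ e ∈ G.edgeFinset, edgeWeight e

/-- The symmetric disk graph of a metric space and a range assignment `r`: distinct points `u`, `v`
are adjacent iff both `r u` and `r v` are no smaller than the distance between `u` and `v`. -/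
def symmDiskGraph {V : Type*} [MetricSpace V] (r : V → ℝ) : SimpleGraph V where
  Adj u v := u ≠ v ∧ dist u v ≤ r u ∧ dist u v ≤ r v
  symm := ⟨fun u v h => ⟨h.1.symm, dist_comm u v ▸ h.2.2, dist_comm u v ▸ h.2.1⟩⟩
  loopless := ⟨fun _ h => h.1 rfl⟩

/-- `F` is a spanning forest of `G`: an acyclic subgraph of `G` on the same vertex set with the
same connected components as `G`. -/
def IsSpanningForest {V : Type*} (G F : SimpleGraph V) : Prop :=
  F ≤ G ∧ F.IsAcyclic ∧ ∀ u v : V, F.Reachable u v ↔ G.Reachable u v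

/-- `F` is a minimum spanning forest of `G`, with respect to the distances. -/
def IsMinSpanningForest {V : Type*} [MetricSpace V] [Fintype V] (G F : SimpleGraph V) : Prop :=
  IsSpanningForest G F ∧
    ∀ F' : SimpleGraph V, IsSpanningForest G F' → graphWeight F ≤ graphWeight F'

open Classical in
/-- `H` is a Hamiltonian path of the complete graph on `V`: its edges are exactly the edges
traversed by a walk that visits every vertex exactly once. -/
def IsHamiltonianPath {V : Type*} (H : SimpleGraph V) : Prop :=
  ∃ (a b : V) (p : (⊤ : SimpleGraph V).Walk a b),
    p.IsHamiltonian ∧ H.edgeSet = {e | e ∈ p.edges}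

/-- `H` is a Hamiltonian path of minimum weight of the metric space `V`. -/
def IsMinHamiltonianPath {V : Type*} [MetricSpace V] [Fintype V] (H : SimpleGraph V) : Prop :=
  IsHamiltonianPath H ∧
    ∀ H' : SimpleGraph V, IsHamiltonianPath H' → graphWeight H ≤ graphWeight H'

end DiskGraph

namespace DiskGraph

open SimpleGraph

variable {V : Type*}

/-! ### Deleting edges from forests -/

section Graph

/-! Fix `W` and let `k ≥ 1` edges of `F` weigh at least `W`. Deleting them leaves `k + 1` of their
endpoints in distinct components (`exists_pairwise_not_reachable`), and each such endpoint has range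
at least `W`. Two of these at distance below `W` would be adjacent in the disk graph, hence joined
by light edges of `F` (`IsMinSpanningForest.reachable_of_dist_lt`), a contradiction. So they are
`W`-separated, and a Hamiltonian path through them weighs at least `k * W`. Thus the `k`-th heaviest
edge weighs at most `w(H) / k`. There are at most `n - 1` edges, and the harmonic sum telescopes
against `log_{5/4}`. -/

lemma reachable_of_forall_adj {G G' : SimpleGraph V}
    (h : ∀ x y, G.Adj x y → G'.Reachable x y) {a b : V} (hab : G.Reachable a b) :
    G'.Reachable a b := by
  obtain ⟨p⟩ := hab
  induction p with
  | nil => exact .rfl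
  | cons hxy _ ih => exact (h _ _ hxy).trans ih

/-- Reinserting an edge `s(x, y)` connects `a` to `b` either not at all, or by a detour through
that edge. -/
lemma reachable_or_of_reachable_deleteEdges {G : SimpleGraph V} {x y a b : V}
    (hab : G.Reachable a b) :
    (G.deleteEdges {s(x, y)}).Reachable a b ∨
      ((G.deleteEdges {s(x, y)}).Reachable a x ∧ (G.deleteEdges {s(x, y)}).Reachable y b) ∨
      ((G.deleteEdges {s(x, y)}).Reachable a y ∧ (G.deleteEdges {s(x, y)}).Reachable x b) := by
  obtain ⟨p⟩ := hab
  induction p with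
  | nil => exact .inl .rfl
  | @cons u v w huv _ ih =>
    by_cases he : s(u, v) = s(x, y)
    · rcases Sym2.eq_iff.1 he with ⟨rfl, rfl⟩ | ⟨rfl, rfl⟩
      · rcases ih with h | ⟨_, h⟩ | ⟨_, h⟩
        · exact .inr (.inl ⟨.rfl, h⟩)
        · exact .inr (.inl ⟨.rfl, h⟩)
        · exact .inl h
      · rcases ih with h | ⟨_, h⟩ | ⟨_, h⟩
        · exact .inr (.inr ⟨.rfl, h⟩)
        · exact .inl h
        · exact .inr (.inr ⟨.rfl, h⟩)
    · have huv' : (G.deleteEdges {s(x, y)}).Reachable u v :=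
        (deleteEdges_adj.2 ⟨huv, by simpa using he⟩ : (G.deleteEdges {s(x, y)}).Adj u v).reachable
      rcases ih with h | ⟨h, h'⟩ | ⟨h, h'⟩
      · exact .inl (huv'.trans h)
      · exact .inr (.inl ⟨huv'.trans h, h'⟩)
      · exact .inr (.inr ⟨huv'.trans h, h'⟩)

/-- In an acyclic graph, deleting an edge of the path from `a` to `b` disconnects them. -/
lemma not_reachable_deleteEdges_of_mem_path {G : SimpleGraph V} (hG : G.IsAcyclic) {a b : V}
    {p : G.Walk a b} (hp : p.IsPath) {e : Sym2 V} (he : e ∈ p.edges) :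
    ¬ (G.deleteEdges {e}).Reachable a b := by
  intro h
  obtain ⟨q, hq⟩ := h.exists_isPath
  have hle : G.deleteEdges {e} ≤ G := deleteEdges_le _
  have heq := congrArg Subtype.val
    ((hG.subsingleton_path a b).elim ⟨p, hp⟩ ⟨q.mapLe hle, hq.mapLe hle⟩)
  simp only at heq
  rw [heq, Walk.edges_mapLe_eq_edges] at he
  simpa using q.edges_subset_edgeSet he

/-- Deleting `k` edges from an acyclic graph leaves at least `k + 1` endpoints of deleted edges in
pairwise distinct components. -/
lemma exists_pairwise_not_reachable {G : SimpleGraph V} (hG : G.IsAcyclic) (U : Set V)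
    (hU : U.Nonempty) (E : Finset (Sym2 V)) (hE : ∀ e ∈ E, e ∈ G.edgeSet ∧ ∀ v ∈ e, v ∈ U) :
    ∃ R : Finset V, (∀ v ∈ R, v ∈ U) ∧ E.card + 1 ≤ R.card ∧
      ∀ u ∈ R, ∀ v ∈ R, u ≠ v → ¬ (G.deleteEdges E).Reachable u v := by
  classical
  induction E using Finset.induction_on with
  | empty =>
    obtain ⟨u, hu⟩ := hU
    exact ⟨{u}, by simpa using hu, by simp, by simp +contextual⟩
  | insert e E heE ih =>
    obtain ⟨R, hRU, hcard, hR⟩ := ih fun e he => hE e (Finset.mem_insert_of_mem he)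
    obtain ⟨heG, heU⟩ := hE e (Finset.mem_insert_self _ _)
    induction e with | h x y => ?_
    set D := G.deleteEdges (E : Set (Sym2 V)) with hD
    have hxyD : D.Adj x y := deleteEdges_adj.2 ⟨heG, by simpa using heE⟩
    have hD' : G.deleteEdges (insert s(x, y) E : Finset _) = D.deleteEdges {s(x, y)} := by
      rw [hD, deleteEdges_deleteEdges, Finset.coe_insert, Set.insert_eq, Set.union_comm]
    have hle : D.deleteEdges {s(x, y)} ≤ D := deleteEdges_le _
    have hbridge : ¬ (D.deleteEdges {s(x, y)}).Reachable x y :=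
      isBridge_iff.1 (isAcyclic_iff_forall_isBridge.1 (hG.anti (deleteEdges_le _)) hxyD)
    -- Deleting `s(x, y)` splits one component, which holds at most one representative; trading it
    -- for both `x` and `y` gains at least one.
    set R₀ := R.filter fun v => ¬ D.Reachable v x with hR₀
    have hsplit : (R.filter fun v => D.Reachable v x).card ≤ 1 := by
      refine Finset.card_le_one.2 fun u hu v hv => ?_
      rw [Finset.mem_filter] at hu hv
      by_contra huv
      exact hR u hu.1 v hv.1 huv (hu.2.trans hv.2.symm)
    have hx : ∀ v ∈ R₀, ¬ D.Reachable v x := fun v hv => (Finset.mem_filter.1 hv).2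
    have hy : ∀ v ∈ R₀, ¬ D.Reachable v y := fun v hv h =>
      hx v hv (h.trans hxyD.symm.reachable)
    have hyR : y ∉ R₀ := fun h => hy y h .rfl
    have hxR : x ∉ insert y R₀ := by
      rw [Finset.mem_insert, not_or]
      exact ⟨hxyD.ne, fun h => hx x h .rfl⟩
    refine ⟨insert x (insert y R₀), ?_, ?_, ?_⟩
    · intro v hv
      simp only [Finset.mem_insert] at hv
      rcases hv with rfl | rfl | hv
      · exact heU _ (by simp)
      · exact heU _ (by simp)
      · exact hRU v (Finset.mem_filter.1 hv).1
    · rw [Finset.card_insert_of_notMem hxR, Finset.card_insert_of_notMem hyR,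
        Finset.card_insert_of_notMem heE]
      have hadd : (R.filter fun v => D.Reachable v x).card + R₀.card = R.card := by
        rw [hR₀]
        convert Finset.card_filter_add_card_filter_not (s := R) (fun v => D.Reachable v x)
      omega
    · rw [hD']
      intro u hu v hv huv h
      simp only [Finset.mem_insert] at hu hv
      rcases hu with rfl | rfl | hu <;> rcases hv with rfl | rfl | hv
      · exact huv rfl
      · exact hbridge h
      · exact hx v hv (h.mono hle).symm
      · exact hbridge h.symm
      · exact huv rfl
      · exact hy v hv (h.mono hle).symm
      · exact hx u hu (h.mono hle)
      · exact hy u hu (h.mono hle)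
      · exact hR u (Finset.mem_filter.1 hu).1 v (Finset.mem_filter.1 hv).1 huv (h.mono hle)

lemma card_edgeFinset_add_one_le [Fintype V] [Nonempty V] {F : SimpleGraph V} [Fintype F.edgeSet]
    (hF : F.IsAcyclic) : F.edgeFinset.card + 1 ≤ Fintype.card V := by
  obtain ⟨R, -, hcard, -⟩ := exists_pairwise_not_reachable hF Set.univ Set.univ_nonempty
    F.edgeFinset fun e he => ⟨mem_edgeFinset.1 he, fun _ _ => Set.mem_univ _⟩
  exact hcard.trans R.card_le_univ

end Graph

/-! ### Separated sets, Hamiltonian paths and the cycle property -/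

section Metric

variable [MetricSpace V]

@[simp]
lemma edgeWeight_mk (u v : V) : edgeWeight s(u, v) = dist u v := rfl

lemma edgeWeight_nonneg (e : Sym2 V) : 0 ≤ edgeWeight e := by
  induction e with | h u v => exact dist_nonneg

lemma graphWeight_eq_sum [Fintype V] (G : SimpleGraph V) [Fintype G.edgeSet] :
    graphWeight G = ∑ e ∈ G.edgeFinset, edgeWeight e := by
  rw [graphWeight]
  congr!

/-- A walk visiting every point of a `W`-separated set `R` has length at least
`(#R - 1) * W`, plus the distance from its start to some point of `R`. -/
lemma exists_dist_add_le_sum_edges {W : ℝ} {G : SimpleGraph V} {a b : V} (p : G.Walk a b)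
    (R : Finset V) (hne : R.Nonempty) (hsub : ∀ v ∈ R, v ∈ p.support)
    (hsep : ∀ u ∈ R, ∀ v ∈ R, u ≠ v → W ≤ dist u v) :
    ∃ z ∈ R, dist a z + ((R.card : ℝ) - 1) * W ≤ (p.edges.map edgeWeight).sum := by
  classical
  induction p generalizing R with
  | @nil u =>
    have hR : R = {u} := Finset.eq_singleton_iff_nonempty_unique_mem.2
      ⟨hne, fun v hv => by simpa using hsub v hv⟩
    exact ⟨u, by simp [hR], by simp [hR]⟩
  | @cons a c b hac q ih =>
    simp only [Walk.edges_cons, List.map_cons, List.sum_cons, edgeWeight_mk]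
    -- If `a ∈ R`, the distance from `c` to the point found for `R.erase a` pays, with the first
    -- edge, for one more gap `W`.
    by_cases ha : a ∈ R
    · have hcard := Finset.card_erase_add_one ha
      rcases (R.erase a).eq_empty_or_nonempty with he | hne'
      · have hsum : 0 ≤ (q.edges.map edgeWeight).sum :=
          List.sum_nonneg fun x hx => by
            obtain ⟨e, -, rfl⟩ := List.mem_map.1 hx
            exact edgeWeight_nonneg e
        rw [he, Finset.card_empty] at hcard
        refine ⟨a, ha, ?_⟩
        rw [← hcard]
        simpa using add_nonneg dist_nonneg hsum
      · obtain ⟨z, hz, hle⟩ := ih (R.erase a) hne'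
          (fun v hv => by
            have := hsub v (Finset.mem_of_mem_erase hv)
            rw [Walk.support_cons, List.mem_cons] at this
            exact this.resolve_left (Finset.ne_of_mem_erase hv))
          (fun u hu v hv => hsep u (Finset.mem_of_mem_erase hu) v (Finset.mem_of_mem_erase hv))
        have hW := hsep a ha z (Finset.mem_of_mem_erase hz) (Finset.ne_of_mem_erase hz).symm
        have htri := dist_triangle a c z
        refine ⟨a, ha, ?_⟩
        rw [← hcard, _root_.dist_self]
        push_cast
        linarith
    · obtain ⟨z, hz, hle⟩ := ih R hne
        (fun v hv => by
          have := hsub v hv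
          rw [Walk.support_cons, List.mem_cons] at this
          exact this.resolve_left fun h => ha (h ▸ hv)) hsep
      have htri := dist_triangle a c z
      exact ⟨z, hz, by linarith⟩

variable [Fintype V]

lemma IsHamiltonianPath.card_sub_one_mul_le {H : SimpleGraph V} (hH : IsHamiltonianPath H) {W : ℝ}
    (R : Finset V) (hne : R.Nonempty) (hsep : ∀ u ∈ R, ∀ v ∈ R, u ≠ v → W ≤ dist u v) :
    ((R.card : ℝ) - 1) * W ≤ graphWeight H := by
  classical
  obtain ⟨a, b, p, hp, hedge⟩ := hH
  obtain ⟨z, -, hz⟩ := exists_dist_add_le_sum_edges p R hne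
    (fun v _ => List.count_pos_iff.1 (by rw [hp v]; exact one_pos)) hsep
  have hnodup : p.edges.Nodup :=
    Walk.edges_nodup_of_support_nodup (List.nodup_iff_count_le_one.2 fun v => (hp v).le)
  have hfin : H.edgeFinset = p.edges.toFinset := by
    ext e
    rw [mem_edgeFinset, hedge]
    simp
  have hw : graphWeight H = (p.edges.map edgeWeight).sum := by
    rw [graphWeight_eq_sum, ← List.sum_toFinset _ hnodup, ← hfin]
  have := dist_nonneg (x := a) (y := z)
  linarith

/-- The cycle property of minimum spanning forests: the edges of a minimum spanning forest that
are lighter than `W` connect the endpoints of every edge lighter than `W`. -/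
lemma IsMinSpanningForest.reachable_of_dist_lt {S F : SimpleGraph V}
    (hF : IsMinSpanningForest S F) {W : ℝ} {a b : V} (hab : S.Adj a b) (hW : dist a b < W) :
    (F.deleteEdges {e | W ≤ edgeWeight e}).Reachable a b := by
  classical
  obtain ⟨⟨hle, hac, hreach⟩, hmin⟩ := hF
  by_contra hcon
  have hFab : F.Reachable a b := (hreach a b).2 hab.reachable
  obtain ⟨p, hp⟩ := hFab.exists_isPath
  obtain ⟨e, hep, heW⟩ : ∃ e ∈ p.edges, W ≤ edgeWeight e := by
    by_contra! h
    exact hcon ⟨p.toDeleteEdges _ fun e he => not_le.2 (h e he)⟩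
  have heF : e ∈ F.edgeSet := p.edges_subset_edgeSet hep
  have hnot := not_reachable_deleteEdges_of_mem_path hac hp hep
  have hdle : F.deleteEdges {e} ≤ F := deleteEdges_le _
  -- Exchange: the heavy edge `e` is replaced by the strictly lighter edge from `a` to `b`.
  set F' := F.deleteEdges {e} ⊔ edge a b with hF'
  have hab' : F'.Adj a b := Or.inr ((edge_adj ..).2 ⟨.inl ⟨rfl, rfl⟩, hab.ne⟩)
  have hF'S : F' ≤ S :=
    sup_le (hdle.trans hle) ((edge_le_iff S).2 (.inr hab))
  have hconn : ∀ x y, F.Adj x y → F'.Reachable x y := by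
    intro x y hxy
    by_cases he : s(x, y) = e
    · subst he
      have hsub : F.deleteEdges {s(x, y)} ≤ F' := le_sup_left
      rcases reachable_or_of_reachable_deleteEdges (x := x) (y := y) hFab with h | ⟨h, h'⟩ | ⟨h, h'⟩
      · exact absurd h hnot
      · exact ((h.mono hsub).symm.trans hab'.reachable).trans (h'.mono hsub).symm
      · exact ((h'.mono hsub).trans hab'.reachable.symm).trans (h.mono hsub)
    · exact Adj.reachable (Or.inl (deleteEdges_adj.2 ⟨hxy, by simpa using he⟩))
  have hspan : IsSpanningForest S F' :=
    ⟨hF'S, hac.anti hdle |>.sup_edge_of_not_reachable hnot, fun u v =>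
      ⟨fun h => h.mono hF'S, fun h => reachable_of_forall_adj hconn ((hreach u v).2 h)⟩⟩
  have hfin : F'.edgeFinset = insert s(a, b) (F.edgeFinset.erase e) := by
    ext d
    induction d with | h u v => ?_
    simp only [mem_edgeFinset, mem_edgeSet, Finset.mem_insert, Finset.mem_erase, hF', sup_adj,
      deleteEdges_adj, edge_adj, Set.mem_singleton_iff, Sym2.eq_iff]
    have := hab.ne
    constructor
    · rintro (⟨h, h'⟩ | ⟨h, -⟩)
      · exact .inr ⟨h', h⟩
      · exact .inl (by tauto)
    · rintro (h | ⟨h, h'⟩)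
      · refine .inr ⟨by tauto, ?_⟩
        rcases h with ⟨rfl, rfl⟩ | ⟨rfl, rfl⟩
        · exact hab.ne
        · exact hab.ne.symm
      · exact .inl ⟨h', h⟩
  have hlt : graphWeight F' < graphWeight F := by
    have hnm : s(a, b) ∉ F.edgeFinset.erase e := by
      intro h
      rw [Finset.mem_erase, mem_edgeFinset] at h
      exact hnot (Adj.reachable (deleteEdges_adj.2 ⟨h.2, by simpa using h.1⟩))
    have h1 := Finset.add_sum_erase F.edgeFinset edgeWeight (mem_edgeFinset.2 heF)
    have h2 : graphWeight F' = ∑ d ∈ insert s(a, b) (F.edgeFinset.erase e), edgeWeight d := by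
      rw [← hfin, graphWeight_eq_sum]
    rw [Finset.sum_insert hnm, edgeWeight_mk] at h2
    have h3 := graphWeight_eq_sum F
    linarith
  exact absurd (hmin F' hspan) (not_le.2 hlt)

/-- A minimum spanning forest of a symmetric disk graph has at most `w(H) / W` edges of weight at
least `W`, for every Hamiltonian path `H`. -/
lemma IsMinSpanningForest.card_mul_le {r : V → ℝ} {F H : SimpleGraph V}
    (hF : IsMinSpanningForest (symmDiskGraph r) F) (hH : IsHamiltonianPath H) {W : ℝ}
    {E : Finset (Sym2 V)} (hE : ∀ e, e ∈ E ↔ e ∈ F.edgeSet ∧ W ≤ edgeWeight e)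
    (hne : E.Nonempty) (hW : 0 ≤ W) : E.card * W ≤ graphWeight H := by
  have hends : ∀ e ∈ E, e ∈ F.edgeSet ∧ ∀ v ∈ e, v ∈ {v | W ≤ r v} := by
    intro e he
    obtain ⟨heF, heW⟩ := (hE e).1 he
    refine ⟨heF, ?_⟩
    induction e with | h x y => ?_
    obtain ⟨-, hx, hy⟩ := hF.1.1 heF
    intro v hv
    rcases Sym2.mem_iff.1 hv with rfl | rfl
    · exact heW.trans hx
    · exact heW.trans hy
  have hU : {v | W ≤ r v}.Nonempty := by
    obtain ⟨e, he⟩ := hne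
    obtain ⟨v, hv⟩ : ∃ v, v ∈ e := ⟨_, Sym2.out_fst_mem e⟩
    exact ⟨v, (hends e he).2 v hv⟩
  obtain ⟨R, hRU, hcard, hR⟩ := exists_pairwise_not_reachable hF.1.2.1 _ hU E hends
  have hle : F.deleteEdges {e | W ≤ edgeWeight e} ≤ F.deleteEdges (E : Set (Sym2 V)) := by
    intro x y hxy
    rw [deleteEdges_adj] at hxy ⊢
    exact ⟨hxy.1, fun h => hxy.2 ((hE _).1 h).2⟩
  have hsep : ∀ u ∈ R, ∀ v ∈ R, u ≠ v → W ≤ dist u v := by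
    intro u hu v hv huv
    by_contra! hlt
    have hadj : (symmDiskGraph r).Adj u v :=
      ⟨huv, hlt.le.trans (hRU u hu), hlt.le.trans (hRU v hv)⟩
    exact hR u hu v hv huv ((hF.reachable_of_dist_lt hadj hlt).mono hle)
  have hpath := hH.card_sub_one_mul_le R (Finset.card_pos.1 (by omega)) hsep
  have hcard' : (E.card : ℝ) ≤ R.card - 1 := by
    have : ((E.card + 1 : ℕ) : ℝ) ≤ R.card := Nat.cast_le.2 hcard
    push_cast at this
    linarith
  exact (mul_le_mul_of_nonneg_right hcard' hW).trans hpath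

end Metric

/-! ### Harmonic sum against the logarithm -/

section Sum

lemma one_div_le_logb_sub_logb (k : ℕ) (hk : 1 ≤ k) :
    (1 : ℝ) / k ≤ Real.logb (5 / 4) (k + 1) - Real.logb (5 / 4) k := by
  have hk' : (1 : ℝ) ≤ k := by exact_mod_cast hk
  have hk0 : (0 : ℝ) < k := by linarith
  have hlog : 0 < Real.log (5 / 4) := Real.log_pos (by norm_num)
  -- Any bound up to `1 / 2` would do, since `k / (k + 1) ≥ 1 / 2`.
  have hlog' : Real.log (5 / 4) ≤ 1 / 4 :=
    (Real.log_le_sub_one_of_pos (by norm_num)).trans (by norm_num)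
  have hstep : 1 / ((k : ℝ) + 1) ≤ Real.log (k + 1) - Real.log k := by
    have h := Real.one_sub_inv_le_log_of_pos (x := ((k : ℝ) + 1) / k) (by positivity)
    rw [Real.log_div (by positivity) hk0.ne'] at h
    refine le_trans (le_of_eq ?_) h
    field_simp
    ring
  rw [Real.logb, Real.logb, ← sub_div, le_div_iff₀ hlog]
  refine le_trans ?_ hstep
  calc 1 / (k : ℝ) * Real.log (5 / 4) ≤ 1 / (k : ℝ) * (1 / 4) := by gcongr
    _ ≤ 1 / ((k : ℝ) + 1) := by
      rw [div_mul_div_comm, div_le_div_iff₀ (by positivity) (by positivity)]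
      linarith

/-- If for every `W` among the values of `f` at most `A / W` values are at least `W`, then
the values sum to at most `A * log (n + 1)`, where `n` is their number. -/
lemma sum_le_logb_mul {ι : Type*} (f : ι → ℝ) (hf : ∀ i, 0 ≤ f i) {A : ℝ} (s : Finset ι)
    (h : ∀ i ∈ s, (s.filter fun j => f i ≤ f j).card * f i ≤ A) :
    ∑ i ∈ s, f i ≤ Real.logb (5 / 4) (s.card + 1) * A := by
  classical
  induction hn : s.card generalizing s with
  | zero => simp [Finset.card_eq_zero.1 hn]
  | succ n ih =>
    have hne : s.Nonempty := Finset.card_pos.1 (by omega)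
    -- All `n + 1` values are at least the smallest one, so it is at most `A / (n + 1)`; erasing it
    -- only lowers the other counts.
    obtain ⟨i, hi, hmin⟩ := s.exists_min_image f hne
    have hsum := Finset.add_sum_erase s f hi
    have herase : (s.erase i).card = n := by rw [Finset.card_erase_of_mem hi, hn]; rfl
    have hrec := ih (s.erase i) (fun j hj => by
      refine le_trans (mul_le_mul_of_nonneg_right ?_ (hf j)) (h j (Finset.mem_of_mem_erase hj))
      exact_mod_cast Finset.card_le_card
        (Finset.filter_subset_filter _ (Finset.erase_subset i s))) herase
    have hi' := h i hi
    rw [Finset.filter_true_of_mem hmin, hn] at hi'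
    have hA : 0 ≤ A := le_trans (mul_nonneg (Nat.cast_nonneg _) (hf i)) hi'
    have hpos : (0 : ℝ) < ((n + 1 : ℕ) : ℝ) := by positivity
    have hfi : f i ≤ 1 / ((n + 1 : ℕ) : ℝ) * A := by
      rw [one_div_mul_eq_div, le_div_iff₀ hpos, mul_comm]
      exact hi'
    have hlog := mul_le_mul_of_nonneg_right (one_div_le_logb_sub_logb (n + 1) (by omega)) hA
    rw [sub_mul] at hlog
    push_cast at *
    linarith

end Sum

end DiskGraph

open DiskGraph in
theorem lemma2 {V : Type*} [MetricSpace V] [Fintype V] [Nonempty V] (r : V → ℝ)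
    (hr : ∀ v, 0 < r v) (F H : SimpleGraph V)
    (hF : DiskGraph.IsMinSpanningForest (DiskGraph.symmDiskGraph r) F)
    (hH : DiskGraph.IsMinHamiltonianPath H) :
    DiskGraph.graphWeight F ≤
      Real.logb (5 / 4) (Fintype.card V : ℝ) * DiskGraph.graphWeight H := by
  classical
  have hH0 : 0 ≤ graphWeight H := by
    rw [graphWeight_eq_sum]
    exact Finset.sum_nonneg fun e _ => edgeWeight_nonneg e
  have hsum : graphWeight F ≤ Real.logb (5 / 4) (F.edgeFinset.card + 1) * graphWeight H := by
    have h := sum_le_logb_mul (A := graphWeight H) edgeWeight edgeWeight_nonneg F.edgeFinset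
      fun e he => hF.card_mul_le hH.1 (fun d => by
        rw [Finset.mem_filter, SimpleGraph.mem_edgeFinset])
        ⟨e, Finset.mem_filter.2 ⟨he, le_rfl⟩⟩ (edgeWeight_nonneg e)
    rwa [← graphWeight_eq_sum] at h
  refine hsum.trans (mul_le_mul_of_nonneg_right ?_ hH0)
  have hcard : ((F.edgeFinset.card : ℝ) + 1) ≤ Fintype.card V := by
    exact_mod_cast card_edgeFinset_add_one_le hF.1.2.1
  exact Real.logb_le_logb_of_le (by norm_num) (by positivity) hcard
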